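/- Let $n,w$ be integers with $w\ge 2$ and $n\ge 2w$. The Johnson graph $J(n,w)$ has as vertices the binary vectors $x=(x_1,\dots,x_n)$ with exactly $w$ ones, two vertices being adjacent if they have exactly $w-1$ common ones. Put $\lambda_1(n,w)=(w-1)(n-w-1)-1$. A $\lambda$-eigenfunction of a graph is a real-valued function $f\not\equiv 0$ on its vertices such that $\lambda f(x)=\sum_{y\sim x} f(y)$ for every vertex $x$. Theorem. Let $f:J(n,w)\to\{-1,0,1\}$ be a $\lambda_1(n,w)$-eigenfunction of $J(n,w)$. Then there are a coordinate permutation $\pi\in S_n$, a real constant $c\neq 0$ and a function $g$ among the functions $f_1,\dots,f_4$ below, whose stated condition on $n$ and $w$ is satisfied, such that $f(x)=c\,g(\pi x)$ for all vertices $x$ of $J(n,w)$: 1. $f_1(x)=1$ if $x_1=1,\ x_2=0$; $f_1(x)=-1$ if $x_1=0,\ x_2=1$; $f_1(x)=0$ otherwise (no further condition); 2. $f_2(x)=1$ if $x_1=x_2=1$; $f_2(x)=-1$ if $x_1=x_2=0$; $f_2(x)=0$ otherwise (condition: $n=2w$); 3. $f_3(x)=1$ if $x_1=1$; $f_3(x)=-1$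 if $x_1=0$ (condition: $n=2w$); 4. $f_4(x)=1$ if $\mathrm{Supp}(x)\subseteq\{1,\dots,\frac n2\}$; $f_4(x)=-1$ if $\mathrm{Supp}(x)\subseteq\{\frac n2+1,\dots,n\}$; $f_4(x)=0$ otherwise, where $\mathrm{Supp}(x)=\{i: x_i=1\}$ (condition: $w=2$ and $n$ is even). -/

import Mathlib

namespace Johnson

/-- Binary vectors of length `n` with exactly `w` ones, each represented by its support:
the set of coordinate positions carrying a one. -/
abbrev Vertex (n w : ℕ) : Type := {s : Finset (Fin n) // s.card = w}

/-- The `k`-th coordinate of a binary vector, where positions are numbered `1, 2, …, n`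
(position `k` is the element of `Fin n` with value `k - 1`). -/
def coord {n w : ℕ} (x : Vertex n w) (k : ℕ) : ℕ :=
  if ∃ i ∈ x.1, (i : ℕ) + 1 = k then 1 else 0

/-- The Johnson graph `J(n,w)`: two vertices are adjacent if they have exactly `w - 1` common
ones. -/
def graph (n w : ℕ) : SimpleGraph (Vertex n w) where
  Adj x y := (x.1 ∩ y.1).card + 1 = w
  symm := ⟨fun x y h => by rw [Finset.inter_comm]; exact h⟩
  loopless := ⟨fun x h => by rw [Finset.inter_self, x.2] at h; omega⟩

instance (n w : ℕ) : DecidableRel (graph n w).Adj := fun x y =>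
  inferInstanceAs (Decidable ((x.1 ∩ y.1).card + 1 = w))

/-- A `l`-eigenfunction of a finite graph: a real-valued function on the vertices, not identically
zero, with `l * f x = ∑ f y` over the neighbours `y` of `x`, for every vertex `x`. -/
def IsEigenfunction {V : Type*} [Fintype V] (G : SimpleGraph V) [DecidableRel G.Adj]
    (l : ℝ) (f : V → ℝ) : Prop :=
  f ≠ 0 ∧ ∀ x, l * f x = ∑ y ∈ G.neighborFinset x, f y

/-- The number `λ_i(n,w) = (w - i)(n - w - i) - i`. -/
def eigenvalue (n w i : ℕ) : ℝ := ((w : ℝ) - i) * ((n : ℝ) - w - i) - i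

/-- The action of a coordinate permutation on the vertices. -/
def permute {n w : ℕ} (π : Equiv.Perm (Fin n)) (x : Vertex n w) : Vertex n w :=
  ⟨x.1.map π.toEmbedding, by rw [Finset.card_map, x.2]⟩

/-- Two functions on the vertices are equivalent if they differ by a coordinate permutation. -/
def Equivalent {n w : ℕ} (f g : Vertex n w → ℝ) : Prop :=
  ∃ π : Equiv.Perm (Fin n), ∀ x, f x = g (permute π x)

/-- Equivalence up to multiplication by a non-zero constant. -/
def EquivalentUpToScalar {n w : ℕ} (f g : Vertex n w → ℝ) : Prop :=
  ∃ c : ℝ, c ≠ 0 ∧ Equivalent f (c • g)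

/-- `1` if `x₁ = 1, x₂ = 0`; `-1` if `x₁ = 0, x₂ = 1`; `0` otherwise. -/
def f₁ (n w : ℕ) (x : Vertex n w) : ℝ :=
  if coord x 1 = 1 ∧ coord x 2 = 0 then 1
  else if coord x 1 = 0 ∧ coord x 2 = 1 then -1
  else 0

/-- `1` if `x₁ = x₂ = 1`; `-1` if `x₁ = x₂ = 0`; `0` otherwise. -/
def f₂ (n w : ℕ) (x : Vertex n w) : ℝ :=
  if coord x 1 = 1 ∧ coord x 2 = 1 then 1
  else if coord x 1 = 0 ∧ coord x 2 = 0 then -1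
  else 0

/-- `1` if `x₁ = 1`; `-1` if `x₁ = 0`. -/
def f₃ (n w : ℕ) (x : Vertex n w) : ℝ :=
  if coord x 1 = 1 then 1 else -1

/-- `1` if the support lies in `{1, …, n/2}`; `-1` if it lies in `{n/2 + 1, …, n}`;
`0` otherwise. It is used for even `n` only. -/
def f₄ (n w : ℕ) (x : Vertex n w) : ℝ :=
  if ∀ i ∈ x.1, (i : ℕ) + 1 ≤ n / 2 then 1
  else if ∀ i ∈ x.1, n / 2 + 1 ≤ (i : ℕ) + 1 then -1
  else 0

end Johnson

open Finset

/-! Let S be `shadowSum` and C `coverSum`. On w-sets SC = A + w and CS = A + (n - w), with A the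
adjacency operator, so `hf` says SC f = (w-1)(n-w) f. Then C f solves the same problem one level
down; by induction it is a weight sum, and applying S recovers f(x) = ∑_{i ∈ x} a i with ∑ a = 0.

Exchanging one element of a w-set shows that two weights differ by 0, 1 or 2 in absolute value
(`sub_mem_of_sum_mem`). Let d be the maximum minus the minimum. If d = 0 then f = 0. If d = 1 there
are two weights, and balance leaves f₂ or f₄ (`two_valued_weight`). If d = 2 the extreme sums are
forced, so all weights other than one maximum and one minimum agree, which leaves f₁ or ±f₃
(`weight_of_sub_eq_two`). -/

/-- The down operator on functions of finite sets: the sum over the covers of a set. -/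
def coverSum {α : Type*} [Fintype α] [DecidableEq α] (f : Finset α → ℝ) (z : Finset α) : ℝ :=
  ∑ i ∈ zᶜ, f (insert i z)

/-- The sum over the sets obtained by removing one element. -/
def shadowSum {α : Type*} [DecidableEq α] (f : Finset α → ℝ) (x : Finset α) : ℝ :=
  ∑ i ∈ x, f (x.erase i)

/-! ### Shadow and cover operators, and descent to weights -/

section Operators

variable {α : Type*} [Fintype α] [DecidableEq α]

/-- The exchange sum here is the one in `shadowSum_coverSum`: the two composites differ only by a
scalar on each level. -/
theorem coverSum_shadowSum (g : Finset α → ℝ) (z : Finset α) :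
    coverSum (shadowSum g) z =
      (zᶜ.card : ℝ) * g z + ∑ i ∈ zᶜ, ∑ j ∈ z, g (insert i (z.erase j)) := by
  have h : ∀ i ∈ zᶜ, shadowSum g (insert i z) = g z + ∑ j ∈ z, g (insert i (z.erase j)) := by
    intro i hi
    rw [mem_compl] at hi
    rw [shadowSum, sum_insert hi, erase_insert hi]
    congr 1
    refine sum_congr rfl fun j hj => ?_
    rw [erase_insert_of_ne]
    rintro rfl
    exact hi hj
  rw [coverSum, sum_congr rfl h, sum_add_distrib, sum_const, nsmul_eq_mul]

theorem shadowSum_coverSum (g : Finset α → ℝ) (z : Finset α) :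
    shadowSum (coverSum g) z =
      (z.card : ℝ) * g z + ∑ i ∈ zᶜ, ∑ j ∈ z, g (insert i (z.erase j)) := by
  have h : ∀ j ∈ z, coverSum g (z.erase j) = g z + ∑ i ∈ zᶜ, g (insert i (z.erase j)) := by
    intro j hj
    have hc : (z.erase j)ᶜ = insert j zᶜ := by
      ext k
      simp only [mem_compl, mem_erase, mem_insert]
      tauto
    rw [coverSum, hc, sum_insert (by simpa using hj), insert_erase hj]
  rw [shadowSum, sum_congr rfl h, sum_add_distrib, sum_const, nsmul_eq_mul, sum_comm]

omit [Fintype α] in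
theorem shadowSum_sum (b : α → ℝ) (x : Finset α) :
    shadowSum (fun z => ∑ i ∈ z, b i) x = ((x.card : ℝ) - 1) * ∑ i ∈ x, b i := by
  have h : ∀ j ∈ x, ∑ i ∈ x.erase j, b i = ∑ i ∈ x, b i - b j := fun j hj => by
    rw [← add_sum_erase x b hj]; ring
  rw [shadowSum, sum_congr rfl h, sum_sub_distrib, sum_const, nsmul_eq_mul]
  ring

/-- A function on the `(k+1)`-sets in the second eigenspace of the shadow-of-cover operator is
given by summing a balanced weight function. -/
theorem exists_weight_of_shadowSum_coverSum (k : ℕ) (hk : k + 1 < Fintype.card α)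
    (f : Finset α → ℝ)
    (hf : ∀ x : Finset α, x.card = k + 1 →
      shadowSum (coverSum f) x = k * ((Fintype.card α : ℝ) - (k + 1)) * f x) :
    ∃ a : α → ℝ, ∑ i, a i = 0 ∧ ∀ x : Finset α, x.card = k + 1 → f x = ∑ i ∈ x, a i := by
  induction k generalizing f with
  | zero =>
    -- On singletons the eigenvalue is 0, and SC f is the total sum of f: this is the balance
    -- condition.
    refine ⟨fun i => f {i}, ?_, fun x hx => ?_⟩
    · have : 0 < Fintype.card α := by omega
      obtain ⟨i⟩ := Fintype.card_pos_iff.mp this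
      have := hf {i} (by simp)
      simpa [shadowSum, coverSum] using this
    · obtain ⟨i, rfl⟩ := card_eq_one.mp (by simpa using hx)
      simp
  | succ k ih =>
    have hpos : ((k : ℝ) + 1) * ((Fintype.card α : ℝ) - (k + 1 + 1)) ≠ 0 := by
      have : ((k + 1 + 1 : ℕ) : ℝ) < Fintype.card α := by exact_mod_cast hk
      push_cast at this
      have h2 : (0 : ℝ) < (Fintype.card α : ℝ) - (k + 1 + 1) := by linarith
      positivity
    obtain ⟨b, hb0, hb⟩ := ih (by omega) (coverSum f) (fun z hz => by
      have h1 := coverSum_shadowSum (coverSum f) z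
      have h2 := shadowSum_coverSum (coverSum f) z
      have h3 : coverSum (shadowSum (coverSum f)) z =
          (k + 1) * ((Fintype.card α : ℝ) - (k + 1 + 1)) * coverSum f z := by
        rw [coverSum, coverSum, mul_sum]
        refine sum_congr rfl fun i hi => ?_
        rw [hf _ (by rw [card_insert_of_notMem (by simpa using hi), hz])]
        push_cast
        ring
      have hc : ((zᶜ.card : ℕ) : ℝ) = (Fintype.card α : ℝ) - (k + 1) := by
        rw [card_compl, Nat.cast_sub (card_le_univ z), hz]
        push_cast
        ring
      rw [h3, hc] at h1
      rw [h2, hz]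
      push_cast
      linear_combination -h1)
    -- f is S (C f) divided by its nonzero eigenvalue, and S multiplies a weight sum on (k+2)-sets
    -- by k + 1.
    refine ⟨fun i => (k + 1) / (((k : ℝ) + 1) * ((Fintype.card α : ℝ) - (k + 1 + 1))) * b i,
      by rw [← mul_sum, hb0, mul_zero], fun x hx => ?_⟩
    have h1 := hf x hx
    have h2 : shadowSum (coverSum f) x = shadowSum (fun z => ∑ i ∈ z, b i) x :=
      sum_congr rfl fun i hi => hb _ (by rw [card_erase_of_mem hi, hx]; rfl)
    rw [h2, shadowSum_sum, hx] at h1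
    push_cast at h1
    rw [← mul_sum, div_mul_eq_mul_div, eq_div_iff hpos]
    linear_combination -h1

end Operators

/-! ### Adjacency in the Johnson graph as exchange -/

namespace Johnson

theorem mem_neighborFinset_iff {n w : ℕ} (x y : Vertex n w) :
    y ∈ (graph n w).neighborFinset x ↔
      ∃ i ∈ x.1ᶜ, ∃ j ∈ x.1, y.1 = insert i (x.1.erase j) := by
  rw [SimpleGraph.mem_neighborFinset]
  change (x.1 ∩ y.1).card + 1 = w ↔ _
  constructor
  · intro h
    have hx := card_sdiff_add_card_inter x.1 y.1
    have hy := card_sdiff_add_card_inter y.1 x.1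
    rw [x.2] at hx
    rw [y.2, inter_comm] at hy
    obtain ⟨j, hj⟩ := card_eq_one.mp (show (x.1 \ y.1).card = 1 by omega)
    obtain ⟨i, hi⟩ := card_eq_one.mp (show (y.1 \ x.1).card = 1 by omega)
    have hj' : ∀ k, (k ∈ x.1 ∧ k ∉ y.1) ↔ k = j := fun k => by
      rw [← mem_sdiff, hj, mem_singleton]
    have hi' : ∀ k, (k ∈ y.1 ∧ k ∉ x.1) ↔ k = i := fun k => by
      rw [← mem_sdiff, hi, mem_singleton]
    refine ⟨i, mem_compl.mpr ((hi' i).mpr rfl).2, j, ((hj' j).mpr rfl).1, ?_⟩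
    ext k
    have h1 := hj' k
    have h2 := hi' k
    rw [mem_insert, mem_erase]
    tauto
  · rintro ⟨i, hi, j, hj, h⟩
    rw [mem_compl] at hi
    have : x.1 ∩ y.1 = x.1.erase j := by
      rw [h]
      ext k
      simp only [mem_inter, mem_insert, mem_erase]
      constructor
      · rintro ⟨h1, rfl | h2⟩
        · exact absurd h1 hi
        · exact h2
      · rintro ⟨h1, h2⟩
        exact ⟨h2, Or.inr ⟨h1, h2⟩⟩
    rw [this, card_erase_of_mem hj, x.2]
    have := card_pos.mpr ⟨j, hj⟩
    rw [x.2] at this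
    omega

theorem sum_neighborFinset {n w : ℕ} (F : Finset (Fin n) → ℝ) (x : Vertex n w) :
    ∑ y ∈ (graph n w).neighborFinset x, F y.1 =
      ∑ i ∈ x.1ᶜ, ∑ j ∈ x.1, F (insert i (x.1.erase j)) := by
  rw [← sum_product']
  symm
  have hcard : ∀ p ∈ x.1ᶜ ×ˢ x.1, (insert p.1 (x.1.erase p.2)).card = w := by
    intro p hp
    rw [mem_product, mem_compl] at hp
    rw [card_insert_of_notMem (fun h => hp.1 (mem_of_mem_erase h)), card_erase_of_mem hp.2, x.2]
    have := card_pos.mpr ⟨_, hp.2⟩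
    rw [x.2] at this
    omega
  refine sum_bij (fun p hp => (⟨_, hcard p hp⟩ : Vertex n w)) ?_ ?_ ?_ ?_
  · intro p hp
    rw [mem_product] at hp
    exact (mem_neighborFinset_iff x _).mpr ⟨p.1, hp.1, p.2, hp.2, rfl⟩
  · rintro ⟨i, j⟩ hp ⟨i', j'⟩ hp' h
    rw [mem_product, mem_compl] at hp hp'
    have h := Subtype.ext_iff.mp h
    simp only at h hp hp'
    have h1 : i ∈ insert i' (x.1.erase j') := h ▸ mem_insert_self _ _
    have h2 : j ∉ insert i' (x.1.erase j') := by
      rw [← h, mem_insert, mem_erase]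
      rintro (rfl | h3)
      · exact hp.1 hp.2
      · exact h3.1 rfl
    rw [mem_insert, mem_erase] at h1 h2
    push Not at h2
    rw [Prod.mk.injEq]
    refine ⟨h1.resolve_right fun h3 => hp.1 h3.2, ?_⟩
    by_contra hne
    exact h2.2 hne hp.2
  · intro y hy
    obtain ⟨i, hi, j, hj, h⟩ := (mem_neighborFinset_iff x y).mp hy
    exact ⟨(i, j), mem_product.mpr ⟨hi, hj⟩, Subtype.ext h.symm⟩
  · intro p hp
    rfl

/-- The eigenfunctions of `J(n,w)` for the second eigenvalue are the balanced weight sums. -/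
theorem exists_weight_of_isEigenfunction {n w : ℕ} (hw : 1 ≤ w) (hn : w < n)
    {f : Vertex n w → ℝ} (hf : IsEigenfunction (graph n w) (eigenvalue n w 1) f) :
    ∃ a : Fin n → ℝ, ∑ i, a i = 0 ∧ ∀ x, f x = ∑ i ∈ x.1, a i := by
  obtain ⟨k, rfl⟩ : ∃ k, w = k + 1 := ⟨w - 1, by omega⟩
  -- The value 0 off the w-sets is harmless: SC at a w-set evaluates F only at w-sets.
  set F : Finset (Fin n) → ℝ := fun s => if h : s.card = k + 1 then f ⟨s, h⟩ else 0 with hF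
  have hFf : ∀ x : Vertex n (k + 1), F x.1 = f x := fun x => by
    rw [hF]; exact dif_pos x.2
  obtain ⟨a, ha, hax⟩ := exists_weight_of_shadowSum_coverSum k (by simpa using hn) F (by
    intro x hx
    have h1 := hf.2 ⟨x, hx⟩
    simp_rw [← hFf] at h1
    rw [sum_neighborFinset] at h1
    rw [shadowSum_coverSum, ← h1, hx, Fintype.card_fin, eigenvalue]
    push_cast
    ring)
  exact ⟨a, ha, fun x => by rw [← hFf, hax x.1 x.2]⟩

end Johnson
-- Balanced weights whose w-sums lie in {-1, 0, 1}
section Weights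

variable {n w : ℕ} {a : Fin n → ℝ}

theorem exists_card_eq_disjoint (s : Finset (Fin n)) {k : ℕ} (h : k + s.card ≤ n) :
    ∃ t : Finset (Fin n), t.card = k ∧ ∀ i ∈ s, i ∉ t := by
  obtain ⟨t, ht, hk⟩ := exists_subset_card_eq (s := sᶜ) (n := k) (by
    rw [card_compl, Fintype.card_fin]; omega)
  exact ⟨t, hk, fun i hi hit => mem_compl.mp (ht hit) hi⟩

/-- Add i or j to a common (w-1)-set avoiding both: the two sums differ by `a i - a j`. -/
theorem sub_mem_of_sum_mem (hw : 2 ≤ w) (hn : 2 * w ≤ n)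
    (hv : ∀ s : Finset (Fin n), s.card = w →
      ∑ i ∈ s, a i = -1 ∨ ∑ i ∈ s, a i = 0 ∨ ∑ i ∈ s, a i = 1)
    {i j : Fin n} (hij : a j ≤ a i) : a i - a j = 0 ∨ a i - a j = 1 ∨ a i - a j = 2 := by
  by_cases h : i = j
  · simp [h]
  obtain ⟨t, ht, hd⟩ := exists_card_eq_disjoint {i, j} (k := w - 1) (by
    rw [card_pair h]; omega)
  have hi := hd i (by simp)
  have hj := hd j (by simp)
  have h1 := hv (insert i t) (by rw [card_insert_of_notMem hi]; omega)
  have h2 := hv (insert j t) (by rw [card_insert_of_notMem hj]; omega)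
  rw [sum_insert hi] at h1
  rw [sum_insert hj] at h2
  rcases h1 with h1 | h1 | h1 <;> rcases h2 with h2 | h2 | h2
  · left; linarith
  · exfalso; linarith
  · exfalso; linarith
  · right; left; linarith
  · left; linarith
  · exfalso; linarith
  · right; right; linarith
  · right; left; linarith
  · left; linarith

/-- Balanced weights taking two values at distance one, the larger one at most half of the time. -/
theorem two_valued_weight (hw : 2 ≤ w) (hn : 2 * w ≤ n)
    (hv : ∀ s : Finset (Fin n), s.card = w →
      ∑ i ∈ s, a i = -1 ∨ ∑ i ∈ s, a i = 0 ∨ ∑ i ∈ s, a i = 1)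
    (h0 : ∑ i, a i = 0) {H : Finset (Fin n)} (hH : H.Nonempty) (hHn : 2 * H.card ≤ n) {m : ℝ}
    (ha : ∀ k, a k = m + if k ∈ H then 1 else 0) :
    m = -1 / w ∧ w * H.card = n ∧ (H.card = 2 ∨ w = 2) := by
  have hw0 : (0 : ℝ) < w := by exact_mod_cast (by omega : 0 < w)
  have hsum : ∀ s : Finset (Fin n), ∑ i ∈ s, a i = s.card * m + (s ∩ H).card := fun s => by
    simp_rw [ha]
    rw [sum_add_distrib, sum_const, nsmul_eq_mul, sum_boole, filter_mem_eq_inter]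
  have hq : (1 : ℝ) ≤ H.card := by exact_mod_cast hH.card_pos
  have hn0 : (0 : ℝ) < n := by exact_mod_cast (by omega : 0 < n)
  have hqn : 2 * (H.card : ℝ) ≤ n := by exact_mod_cast hHn
  have h0' := hsum univ
  rw [h0, univ_inter, card_univ, Fintype.card_fin] at h0'
  have hm : m < 0 := by
    by_contra hm
    push Not at hm
    have := mul_nonneg hn0.le hm
    linarith
  -- A w-set missing H has the negative sum w * m, so it must be -1.
  have hwm : (w : ℝ) * m = -1 := by
    obtain ⟨s, hs, hd⟩ := exists_card_eq_disjoint H (k := w) (by omega)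
    have hsH : s ∩ H = ∅ := by
      ext k
      simp only [mem_inter, notMem_empty, iff_false]
      exact fun h => hd k h.2 h.1
    have h1 := hv s hs
    rw [hsum, hs, hsH, card_empty, Nat.cast_zero, add_zero] at h1
    have := mul_neg_of_pos_of_neg hw0 hm
    rcases h1 with h1 | h1 | h1
    · exact h1
    · linarith
    · linarith
  have hcard : w * H.card = n := by
    have : (w : ℝ) * H.card = n := by linear_combination -(n : ℝ) * hwm - w * h0'
    exact_mod_cast this
  refine ⟨by field_simp; linarith, hcard, ?_⟩
  -- A single element would give n = w.
  have hH2 : 2 ≤ H.card := by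
    by_contra h
    have : w * H.card ≤ w * 1 := Nat.mul_le_mul_left w (by omega)
    omega
  by_contra! hne
  -- Otherwise some w-set contains three elements of H, and its sum is at least -1 + 3 = 2.
  obtain ⟨t, htH, ht⟩ := exists_subset_card_eq (s := H) (n := 3) (by omega)
  obtain ⟨s, hts, -, hs⟩ := exists_subsuperset_card_eq (s := t) (t := univ) (n := w)
    (subset_univ t) (by omega) (by rw [card_univ, Fintype.card_fin]; omega)
  have h3 : 3 ≤ (s ∩ H).card := ht ▸ card_le_card (subset_inter hts htH)
  have h3' : (3 : ℝ) ≤ (s ∩ H).card := by exact_mod_cast h3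
  have h1 := hv s hs
  rw [hsum, hs, hwm] at h1
  rcases h1 with h1 | h1 | h1 <;> linarith

/-- Balanced weights taking two values at distance two. -/
theorem weight_of_sub_eq_two (hw : 2 ≤ w) (hn : 2 * w ≤ n)
    (hv : ∀ s : Finset (Fin n), s.card = w →
      ∑ i ∈ s, a i = -1 ∨ ∑ i ∈ s, a i = 0 ∨ ∑ i ∈ s, a i = 1)
    (h0 : ∑ i, a i = 0) {i j : Fin n} (hij : a i - a j = 2)
    (hmax : ∀ k, a k ≤ a i) (hmin : ∀ k, a j ≤ a k) :
    (∀ k, a k = (if k = i then 1 else 0) - if k = j then 1 else 0) ∨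
    (n = 2 * w ∧ ∀ k, a k = (if k = i then 2 else 0) - 1 / w) ∨
    (n = 2 * w ∧ ∀ k, a k = 1 / w - if k = j then 2 else 0) := by
  have hne : i ≠ j := by rintro rfl; simp at hij
  -- Two sums in {-1, 0, 1} at distance 2 must be 1 and -1.
  have hT : ∀ t : Finset (Fin n), t.card = w - 1 → i ∉ t → j ∉ t →
      a i + ∑ k ∈ t, a k = 1 := by
    intro t ht hi hj
    have h1 := hv (insert i t) (by rw [card_insert_of_notMem hi]; omega)
    have h2 := hv (insert j t) (by rw [card_insert_of_notMem hj]; omega)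
    rw [sum_insert hi] at h1
    rw [sum_insert hj] at h2
    rcases h1 with h1 | h1 | h1
    · rcases h2 with h2 | h2 | h2 <;> linarith
    · rcases h2 with h2 | h2 | h2 <;> linarith
    · exact h1
  have hconst : ∀ k l, k ≠ i → k ≠ j → l ≠ i → l ≠ j → a k = a l := by
    intro k l hki hkj hli hlj
    by_cases hkl : k = l
    · rw [hkl]
    -- There is room, as (w - 2) + 4 ≤ 2 * w.
    obtain ⟨t, ht, hd⟩ := exists_card_eq_disjoint {i, j, k, l} (k := w - 2) (by
      have := card_le_four (a := i) (b := j) (c := k) (d := l)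
      omega)
    have hi := hd i (by simp)
    have hj := hd j (by simp)
    have hk := hd k (by simp)
    have hl := hd l (by simp)
    have h1 := hT (insert k t) (by rw [card_insert_of_notMem hk]; omega)
      (by simp [hki.symm, hi]) (by simp [hkj.symm, hj])
    have h2 := hT (insert l t) (by rw [card_insert_of_notMem hl]; omega)
      (by simp [hli.symm, hi]) (by simp [hlj.symm, hj])
    rw [sum_insert hk] at h1
    rw [sum_insert hl] at h2
    linarith
  obtain ⟨t, ht, hd⟩ := exists_card_eq_disjoint {i, j} (k := w - 1) (by
    rw [card_pair hne]; omega)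
  have hi := hd i (by simp)
  have hj := hd j (by simp)
  obtain ⟨k₀, hk₀⟩ := card_pos.mp (by omega : 0 < t.card)
  obtain ⟨r, hr⟩ : ∃ r, ∀ k, k ≠ i → k ≠ j → a k = r :=
    ⟨a k₀, fun k h1 h2 => hconst k k₀ h1 h2 (fun h => hi (h ▸ hk₀)) (fun h => hj (h ▸ hk₀))⟩
  have hk₀r : a k₀ = r := hr k₀ (fun h => hi (h ▸ hk₀)) (fun h => hj (h ▸ hk₀))
  have h1 := hT t ht hi hj
  have hall : ∀ k, a k = r + ((if k = i then a i - r else 0) + if k = j then a j - r else 0) := by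
    intro k
    by_cases hki : k = i
    · subst hki; simp [hne]
    · by_cases hkj : k = j
      · subst hkj; simp [hki]
      · simp [hki, hkj, hr k hki hkj]
  rw [sum_congr rfl fun k hk => hr k (fun h => hi (h ▸ hk)) (fun h => hj (h ▸ hk)), sum_const,
    ht, nsmul_eq_mul, Nat.cast_sub (by omega)] at h1
  have h2 : n * r + ((a i - r) + (a j - r)) = 0 := by
    rw [← h0, sum_congr rfl fun k _ => hall k]
    simp [sum_add_distrib]
  have hw0 : (0 : ℝ) < w := by exact_mod_cast (by omega : 0 < w)
  -- The extreme sums give `a i + a j = -2 * (w - 1) * r`; substitute in the balance `h2`.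
  have h3 : ((n : ℝ) - 2 * w) * r = 0 := by push_cast at h1; linarith
  rcases mul_eq_zero.mp h3 with h4 | h4
  · have hn2 : (n : ℝ) = 2 * w := by linarith
    have hn2' : n = 2 * w := by exact_mod_cast hn2
    have hrw : (w : ℝ) * r = 1 - a i + r := by push_cast at h1; linarith
    -- The common weight r is the minimum, the midpoint or the maximum, so w * r is -1, 0 or 1.
    rcases sub_mem_of_sum_mem hw hn hv (hmin k₀) with h5 | h5 | h5
    · right; left
      refine ⟨hn2', fun k => ?_⟩
      have : r = -(1 / w) := by field_simp; linarith
      rw [hall k]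
      by_cases hki : k = i
      · rw [if_pos hki, if_pos hki, if_neg (hki ▸ hne)]; linarith
      · rw [if_neg hki, if_neg hki]
        split_ifs <;> linarith
    · left
      have hr0 : r = 0 := by
        have : (w : ℝ) * r = 0 := by linarith
        exact (mul_eq_zero.mp this).resolve_left hw0.ne'
      intro k
      rw [hall k]
      by_cases hki : k = i
      · rw [if_pos hki, if_pos hki, if_neg (hki ▸ hne), if_neg (hki ▸ hne)]; linarith
      · rw [if_neg hki, if_neg hki]
        split_ifs <;> linarith
    · right; right
      refine ⟨hn2', fun k => ?_⟩
      have : r = 1 / w := by field_simp; linarith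
      rw [hall k]
      by_cases hki : k = i
      · rw [if_pos hki, if_neg (hki ▸ hne), if_neg (hki ▸ hne)]; linarith
      · rw [if_neg hki]
        split_ifs <;> linarith
  · left
    subst h4
    intro k
    rw [hall k]
    by_cases hki : k = i
    · rw [if_pos hki, if_pos hki, if_neg (hki ▸ hne), if_neg (hki ▸ hne)]; linarith
    · rw [if_neg hki, if_neg hki]
      split_ifs <;> linarith

end Weights

/-! ### Permutations with prescribed images -/

theorem Equiv.Perm.exists_apply_eq_pair {α : Type*} [DecidableEq α] {i j k l : α} (hij : i ≠ j)
    (hkl : k ≠ l) : ∃ π : Equiv.Perm α, π i = k ∧ π j = l := by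
  -- Send i to k, then the image of j to l; the second swap fixes k.
  refine ⟨(Equiv.swap i k).trans (Equiv.swap (Equiv.swap i k j) l), ?_, ?_⟩
  · have h : k ≠ Equiv.swap i k j := fun h => hij <| by
      apply (Equiv.swap i k).injective
      rw [Equiv.swap_apply_left, ← h]
    simp [Equiv.swap_apply_of_ne_of_ne h hkl]
  · simp

theorem Equiv.Perm.exists_mem_iff_mem {α : Type*} [Fintype α] [DecidableEq α] {s t : Finset α}
    (h : s.card = t.card) : ∃ π : Equiv.Perm α, ∀ i, π i ∈ t ↔ i ∈ s := by
  let e : {x // x ∈ s} ≃ {x // x ∈ t} := Fintype.equivOfCardEq (by simpa using h)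
  refine ⟨e.extendSubtype, fun i => ⟨fun hi => ?_, fun hi => e.extendSubtype_mem i hi⟩⟩
  by_contra hi'
  exact e.extendSubtype_not_mem i hi' hi

/-! ### Matching weights with f₁, …, f₄ -/

namespace Johnson

theorem coord_permute {n w : ℕ} (π : Equiv.Perm (Fin n)) (x : Vertex n w) {i : Fin n} {k : ℕ}
    (h : (π i : ℕ) + 1 = k) : coord (permute π x) k = if i ∈ x.1 then 1 else 0 := by
  rw [coord]
  refine if_congr ?_ rfl rfl
  constructor
  · rintro ⟨l, hl, hk⟩
    obtain ⟨l', hl', rfl⟩ := mem_map.mp hl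
    have : π l' = π i := Fin.ext (by simp only [Equiv.coe_toEmbedding] at hk; omega)
    rwa [← π.injective this]
  · exact fun hi => ⟨π i, mem_map_of_mem _ hi, h⟩

theorem EquivalentUpToScalar.of_neg {n w : ℕ} {f g : Vertex n w → ℝ}
    (h : EquivalentUpToScalar (fun x => -f x) g) : EquivalentUpToScalar f g := by
  obtain ⟨c, hc, π, hπ⟩ := h
  refine ⟨-c, neg_ne_zero.mpr hc, π, fun x => ?_⟩
  have := hπ x
  simp only [Pi.smul_apply, smul_eq_mul] at this ⊢
  linarith

variable {n w : ℕ} {f : Vertex n w → ℝ}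

theorem equivalentUpToScalar_f₁ {i j : Fin n} (hij : i ≠ j) (hn : 2 ≤ n)
    (hf : ∀ x, f x = ∑ k ∈ x.1, ((if k = i then 1 else 0) - if k = j then 1 else 0)) :
    EquivalentUpToScalar f (f₁ n w) := by
  obtain ⟨π, hi, hj⟩ := Equiv.Perm.exists_apply_eq_pair hij
    (show (⟨0, by omega⟩ : Fin n) ≠ ⟨1, by omega⟩ by simp)
  refine ⟨1, one_ne_zero, π, fun x => ?_⟩
  rw [hf, one_smul, f₁, coord_permute π x (i := i) (by simp [hi]),
    coord_permute π x (i := j) (by simp [hj]), sum_sub_distrib, sum_ite_eq', sum_ite_eq']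
  by_cases h1 : i ∈ x.1 <;> by_cases h2 : j ∈ x.1 <;> simp [h1, h2]

theorem equivalentUpToScalar_f₂ {i j : Fin n} (hij : i ≠ j) (hn : 2 ≤ n) (hw : 2 ≤ w)
    (hf : ∀ x, f x = ∑ k ∈ x.1, (-1 / (w : ℝ) + if k ∈ ({i, j} : Finset (Fin n)) then 1 else 0)) :
    EquivalentUpToScalar f (f₂ n w) := by
  obtain ⟨π, hi, hj⟩ := Equiv.Perm.exists_apply_eq_pair hij
    (show (⟨0, by omega⟩ : Fin n) ≠ ⟨1, by omega⟩ by simp)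
  refine ⟨1, one_ne_zero, π, fun x => ?_⟩
  have hw0 : (w : ℝ) ≠ 0 := by exact_mod_cast (by omega : w ≠ 0)
  have h : ∀ k, (if k ∈ ({i, j} : Finset (Fin n)) then (1 : ℝ) else 0) =
      (if k = i then 1 else 0) + if k = j then 1 else 0 := fun k => by
    by_cases h1 : k = i
    · subst h1; simp [hij]
    · simp [h1]
  simp_rw [h] at hf
  rw [hf, one_smul, f₂, coord_permute π x (i := i) (by simp [hi]),
    coord_permute π x (i := j) (by simp [hj]), sum_add_distrib, sum_add_distrib, sum_const, x.2,
    nsmul_eq_mul, mul_div_cancel₀ _ hw0, sum_ite_eq', sum_ite_eq']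
  by_cases h1 : i ∈ x.1 <;> by_cases h2 : j ∈ x.1 <;> norm_num [h1, h2]

theorem equivalentUpToScalar_f₃ {i : Fin n} (hn : 2 ≤ n) (hw : 2 ≤ w)
    (hf : ∀ x, f x = ∑ k ∈ x.1, ((if k = i then 2 else 0) - 1 / (w : ℝ))) :
    EquivalentUpToScalar f (f₃ n w) := by
  refine ⟨1, one_ne_zero, Equiv.swap i ⟨0, by omega⟩, fun x => ?_⟩
  have hw0 : (w : ℝ) ≠ 0 := by exact_mod_cast (by omega : w ≠ 0)
  rw [hf, one_smul, f₃, coord_permute _ x (i := i) (by simp), sum_sub_distrib, sum_const, x.2,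
    nsmul_eq_mul, mul_div_cancel₀ _ hw0, sum_ite_eq']
  by_cases h1 : i ∈ x.1 <;> norm_num [h1]

theorem equivalentUpToScalar_f₄ {H : Finset (Fin n)} (hH : 2 * H.card = n) (hw : w = 2)
    (hf : ∀ x, f x = ∑ k ∈ x.1, (-1 / (w : ℝ) + if k ∈ H then 1 else 0)) :
    EquivalentUpToScalar f (f₄ n w) := by
  subst hw
  have hcard : H.card = (univ.filter fun i : Fin n => (i : ℕ) < n / 2).card := by
    rw [Fin.card_filter_val_lt]
    omega
  obtain ⟨π, hπ⟩ := Equiv.Perm.exists_mem_iff_mem hcard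
  simp only [mem_filter, mem_univ, true_and] at hπ
  refine ⟨1, one_ne_zero, π, fun x => ?_⟩
  obtain ⟨p, q, hpq, hx⟩ := card_eq_two.mp x.2
  have h1 : (∀ i ∈ (permute π x).1, (i : ℕ) + 1 ≤ n / 2) ↔ p ∈ H ∧ q ∈ H := by
    simp [permute, hx, ← hπ]
  have h2 : (∀ i ∈ (permute π x).1, n / 2 + 1 ≤ (i : ℕ) + 1) ↔ p ∉ H ∧ q ∉ H := by
    simp [permute, hx, ← hπ]
  rw [hf, one_smul, f₄, hx, sum_pair hpq]
  simp only [h1, h2]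
  by_cases hp : p ∈ H <;> by_cases hq : q ∈ H <;> norm_num [hp, hq]

/-- A weight function taking two values at distance one, the larger one at most half of the
time, has sums equivalent to `f₂` or `f₄`. -/
theorem equivalent_of_two_valued_weight (hw : 2 ≤ w) (hn : 2 * w ≤ n) {a : Fin n → ℝ}
    (hf : ∀ x, f x = ∑ i ∈ x.1, a i)
    (hv : ∀ s : Finset (Fin n), s.card = w →
      ∑ i ∈ s, a i = -1 ∨ ∑ i ∈ s, a i = 0 ∨ ∑ i ∈ s, a i = 1)
    (h0 : ∑ i, a i = 0) {H : Finset (Fin n)} (hH : H.Nonempty) (hHn : 2 * H.card ≤ n) {m : ℝ}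
    (ha : ∀ k, a k = m + if k ∈ H then 1 else 0) :
    (n = 2 * w ∧ EquivalentUpToScalar f (f₂ n w)) ∨
    (w = 2 ∧ Even n ∧ EquivalentUpToScalar f (f₄ n w)) := by
  obtain ⟨rfl, hc, h2 | h2⟩ := two_valued_weight hw hn hv h0 hH hHn ha
  · obtain ⟨i, j, hij, rfl⟩ := card_eq_two.mp h2
    exact Or.inl ⟨by rw [← hc, h2, mul_comm], equivalentUpToScalar_f₂ hij (by omega) hw
      fun x => by rw [hf, sum_congr rfl fun k _ => ha k]⟩
  · rw [h2] at hc
    exact Or.inr ⟨h2, ⟨H.card, by omega⟩, equivalentUpToScalar_f₄ hc h2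
      fun x => by rw [hf, sum_congr rfl fun k _ => ha k]⟩

end Johnson

/-! ### The classification -/

open Johnson in
theorem mainTheorem3 (n w : ℕ) (hw : 2 ≤ w) (hn : 2 * w ≤ n)
    (f : Johnson.Vertex n w → ℝ)
    (hval : ∀ x, f x = -1 ∨ f x = 0 ∨ f x = 1)
    (hf : Johnson.IsEigenfunction (Johnson.graph n w) (Johnson.eigenvalue n w 1) f) :
    Johnson.EquivalentUpToScalar f (Johnson.f₁ n w) ∨
    (n = 2 * w ∧ Johnson.EquivalentUpToScalar f (Johnson.f₂ n w)) ∨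
    (n = 2 * w ∧ Johnson.EquivalentUpToScalar f (Johnson.f₃ n w)) ∨
    (w = 2 ∧ Even n ∧ Johnson.EquivalentUpToScalar f (Johnson.f₄ n w)) := by
  obtain ⟨a, h0, ha⟩ := exists_weight_of_isEigenfunction (by omega) (by omega) hf
  have hv : ∀ s : Finset (Fin n), s.card = w →
      ∑ i ∈ s, a i = -1 ∨ ∑ i ∈ s, a i = 0 ∨ ∑ i ∈ s, a i = 1 := fun s hs => by
    have := hval ⟨s, hs⟩
    rwa [ha] at this
  have huniv : (univ : Finset (Fin n)).Nonempty := ⟨⟨0, by omega⟩, mem_univ _⟩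
  obtain ⟨i, -, hi⟩ := exists_max_image univ a huniv
  obtain ⟨j, -, hj⟩ := exists_min_image univ a huniv
  replace hi : ∀ k, a k ≤ a i := fun k => hi k (mem_univ k)
  replace hj : ∀ k, a j ≤ a k := fun k => hj k (mem_univ k)
  rcases sub_mem_of_sum_mem hw hn hv (hj i) with h | h | h
  · have hc : ∀ k, a k = a j := fun k => le_antisymm (by linarith [hi k]) (hj k)
    have hz : a j = 0 := by
      rw [sum_congr rfl fun k _ => hc k, sum_const, card_univ, Fintype.card_fin, nsmul_eq_mul] at h0
      exact (mul_eq_zero.mp h0).resolve_left (by exact_mod_cast (by omega : n ≠ 0))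
    refine absurd (funext fun x => ?_) hf.1
    rw [ha, sum_eq_zero fun k _ => (hc k).trans hz, Pi.zero_apply]
  · set H : Finset (Fin n) := univ.filter fun k => a k = a i with hH
    have haH : ∀ k, a k = a j + if k ∈ H then 1 else 0 := fun k => by
      split_ifs with hk
      · rw [hH, mem_filter] at hk
        linarith [hk.2]
      · have hk' : a k ≠ a i := by simpa [hH] using hk
        rcases sub_mem_of_sum_mem hw hn hv (hj k) with h' | h' | h'
        · linarith
        · exact absurd (by linarith) hk'
        · linarith [hi k]
    rcases le_total (2 * H.card) n with hle | hle
    · rcases equivalent_of_two_valued_weight hw hn ha hv h0 ⟨i, by simp [hH]⟩ hle haH with h' | h'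
      · exact Or.inr (Or.inl h')
      · exact Or.inr (Or.inr (Or.inr h'))
    · have hj' : j ∈ Hᶜ := by
        rw [mem_compl, hH, mem_filter]
        rintro ⟨-, h'⟩
        linarith
      -- Negation makes Hᶜ the set of larger weights, now at most half of the coordinates.
      have := equivalent_of_two_valued_weight (f := fun x => -f x) (a := fun k => -a k)
        (H := Hᶜ) (m := -a i) hw hn (fun x => by rw [ha, sum_neg_distrib])
        (fun s hs => by
          rw [sum_neg_distrib]
          rcases hv s hs with h' | h' | h' <;> rw [h'] <;> norm_num)
        (by rw [sum_neg_distrib, h0, neg_zero]) ⟨j, hj'⟩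
        (by rw [card_compl, Fintype.card_fin]; omega)
        (fun k => by
          rw [haH k]
          by_cases hk : k ∈ H
          · rw [if_pos hk, if_neg (by simpa using hk)]; linarith
          · rw [if_neg hk, if_pos (by simpa using hk)]; linarith)
      rcases this with ⟨h1, h2⟩ | ⟨h1, h2, h3⟩
      · exact Or.inr (Or.inl ⟨h1, h2.of_neg⟩)
      · exact Or.inr (Or.inr (Or.inr ⟨h1, h2, h3.of_neg⟩))
  · have hne : i ≠ j := by rintro rfl; simp at h
    rcases weight_of_sub_eq_two hw hn hv h0 h hi hj with h' | ⟨h1, h'⟩ | ⟨h1, h'⟩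
    · exact Or.inl (equivalentUpToScalar_f₁ hne (by omega)
        fun x => by rw [ha, sum_congr rfl fun k _ => h' k])
    · exact Or.inr (Or.inr (Or.inl ⟨h1, equivalentUpToScalar_f₃ (by omega) hw
        fun x => by rw [ha, sum_congr rfl fun k _ => h' k]⟩))
    · refine Or.inr (Or.inr (Or.inl ⟨h1, EquivalentUpToScalar.of_neg
        (equivalentUpToScalar_f₃ (i := j) (by omega) hw fun x => ?_)⟩))
      rw [ha, sum_congr rfl fun k _ => h' k, ← sum_neg_distrib]
      exact sum_congr rfl fun k _ => by ring
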